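/- **Lemma 1.4.** Let $\ell_n:[0,1]\times\mathbb{S}^1\to\mathbb{R}^3$, $n\in\mathbb{N}$, be a sequence of uniformly Lipschitz maps (that is, all $\ell_n$ are Lipschitz with one and the same constant) which converges uniformly to a Lipschitz map $\ell:[0,1]\times\mathbb{S}^1\to\mathbb{R}^3$. Write $S_\ell:=\ell([0,1]\times\mathbb{S}^1)$ and $S_{\ell_n}:=\ell_n([0,1]\times\mathbb{S}^1)$ for the images, and let $\mathcal{H}^2$ be the two-dimensional Hausdorff measure on $\mathbb{R}^3$ (normalized to agree with area on planes). Then for every open set $A\subset\mathbb{R}^3$, $$\mathcal{H}^2(S_\ell\cap A)\;\le\;\liminf_{n\to\infty}\mathcal{H}^2(S_{\ell_n}\cap A).$$ -/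

import Mathlib

open Filter Topology MeasureTheory
open scoped NNReal ENNReal MeasureTheory

/-- Euclidean three-space `ℝ³`. -/
abbrev Space3 : Type := EuclideanSpace ℝ (Fin 3)

/-- The parameter cylinder `[0,1] × 𝕊¹`; `Circle` is the unit circle in `ℂ` with the metric of `ℂ`.
The product carries the maximum metric, which is bi-Lipschitz equivalent to the usual Euclidean
(or arc length) product metric, so it has the same (uniformly) Lipschitz maps. -/
abbrev Cylinder : Type := Set.Icc (0 : ℝ) 1 × Circle

/-- The surface `S_ℓ = ℓ([0,1] × 𝕊¹)` parametrized by `ℓ`. -/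
def surfaceOf (ℓ : Cylinder → Space3) : Set Space3 := Set.range ℓ

/-- The measure `ℋ² ⌞ S_ℓ`. Here `μHE[2]` is the two-dimensional Hausdorff measure on `ℝ³`,
normalized so that it agrees with area (two-dimensional Lebesgue measure) on planes. -/
noncomputable def surfaceMeasure (ℓ : Cylinder → Space3) : Measure Space3 :=
  (μHE[2] : Measure Space3).restrict (surfaceOf ℓ)

/-! Area is compared through shadows on planes. Let `F` be Lipschitz on the plane and `P` a linear
map to ℂ. Where `P ∘ F` has invertible differential, a degree argument shows that its value is also
taken nearby by `P ∘ Fn` for all large `n`; the remaining values form a null set. So the area of the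
shadow of an open part of the surface is lower semicontinuous
(`hausdorffMeasure_image_clm_le_liminf`).

Up to a null set, the image of `F` is covered by countably many closed pieces, each having a
projection that shrinks distances by at most a factor `C`, for any `C > 1`. On such a piece, passing
to the shadow costs a factor `C ^ 2`. The local estimates add up because the liminf, as a function
of the open set, is superadditive on disjoint sets. Then `C` tends to 1. The cylinder is reached by
unrolling it onto the plane. -/

/-! ### Stability of values at points with invertible differential -/

/-- A continuous map of the plane that moves no point of the circle of radius `r` by `r` or more
takes the value `0` in the closed disk bounded by that circle. -/
theorem Complex.exists_mem_closedBall_eq_zero {g : ℂ → ℂ} (hg : Continuous g) {r : ℝ} (hr : 0 < r)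
    (h : ∀ z, ‖z‖ = r → ‖g z - z‖ < r) : ∃ z ∈ Metric.closedBall (0 : ℂ) r, g z = 0 := by
  by_contra! hne
  -- The radial retraction onto the disk makes `g ∘ ρ` zero-free on all of ℂ, so it has a global
  -- logarithm `H`.
  let ρ : ℂ → ℂ := fun z ↦ ((r / max r ‖z‖ : ℝ) : ℂ) * z
  have hmax : ∀ z : ℂ, max r ‖z‖ ≠ 0 := fun z ↦ (lt_max_of_lt_left hr).ne'
  have hρ : Continuous ρ := by
    refine (Complex.continuous_ofReal.comp ?_).mul continuous_id
    exact continuous_const.div (continuous_const.max continuous_norm) hmax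
  have hρ_mem : ∀ z, ρ z ∈ Metric.closedBall (0 : ℂ) r := by
    intro z
    have hm : 0 < max r ‖z‖ := lt_max_of_lt_left hr
    rw [mem_closedBall_zero_iff, norm_mul, Complex.norm_real, Real.norm_of_nonneg (by positivity),
      div_mul_eq_mul_div, div_le_iff₀ hm]
    gcongr
    exact le_max_right _ _
  have hρ_eq : ∀ z, ‖z‖ = r → ρ z = z := by
    intro z hz
    simp [ρ, hz, hr.ne']
  let k : C(ℂ, {z : ℂ // z ≠ 0}) :=
    ⟨fun z ↦ ⟨g (ρ z), hne _ (hρ_mem z)⟩, (hg.comp hρ).subtype_mk _⟩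
  obtain ⟨H, hH0, hH⟩ := (Complex.isCoveringMap_exp.existsUnique_continuousMap_lifts k 0
    (Complex.log (k 0)) (Subtype.ext (Complex.exp_log (k 0).2))).exists
  have hH' : ∀ z, Complex.exp (H z) = g (ρ z) := fun z ↦ congr_arg Subtype.val (congr_fun hH z)
  let c : ℝ → ℂ := fun b ↦ r * Complex.exp (b * Complex.I)
  have hc : Continuous c := by fun_prop
  have hcr : ∀ b, ‖c b‖ = r := fun b ↦ by
    simp [c, Complex.norm_exp_ofReal_mul_I, abs_of_pos hr]
  have hc0 : ∀ b, c b ≠ 0 := fun b hb ↦ hr.ne' (by rw [← hcr b, hb, norm_zero])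
  let u : ℝ → ℂ := fun b ↦ g (c b) / c b
  have hu : Continuous u := (hg.comp hc).div hc hc0
  have hus : ∀ b, u b ∈ Complex.slitPlane := by
    intro b
    refine Complex.mem_slitPlane_of_norm_lt_one (z := u b - 1) ?_ |> fun h ↦ by simpa using h
    have : u b - 1 = (g (c b) - c b) / c b := by simp only [u]; field_simp [hc0 b]
    rw [this, norm_div, hcr, div_lt_one hr]
    exact h _ (hcr b)
  have hlog : Continuous fun b ↦ Complex.log (u b) := continuous_iff_continuousAt.2 fun b ↦
    (hu.continuousAt).clog (hus b)
  -- A second logarithm of `g` along the circle: it gains `2πi` over one turn, whereas `H ∘ c` is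
  -- periodic.
  let φ : ℝ → ℂ := fun b ↦ Complex.log (u b) + b * Complex.I + (H (c 0) - Complex.log (u 0))
  have hφ : Continuous φ := by fun_prop
  have hexp : ∀ b, Complex.exp (φ b) = Complex.exp (H (c b)) := by
    intro b
    have hg0 : g (c 0) ≠ 0 := hne _ (by simp [hcr])
    simp only [φ]
    rw [Complex.exp_add, Complex.exp_add, Complex.exp_sub, hH', hH', hρ_eq _ (hcr b),
      hρ_eq _ (hcr 0), Complex.exp_log (Complex.slitPlane_ne_zero (hus b)),
      Complex.exp_log (Complex.slitPlane_ne_zero (hus 0))]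
    have h1 := hc0 b
    have h0 := hc0 0
    have hcb : Complex.exp (b * Complex.I) = c b / c 0 := by
      rw [eq_div_iff h0]
      simp [c, mul_comm]
    rw [hcb]
    simp only [u]
    field_simp
  have key := Complex.isCoveringMap_exp.eq_of_comp_eq hφ (H.continuous.comp hc)
    (funext fun b ↦ Subtype.ext (hexp b)) 0 (by simp [φ])
  have h2 := congr_fun key (2 * Real.pi)
  have hcc : c (2 * Real.pi) = c 0 := by simp [c, Complex.exp_two_pi_mul_I]
  have huu : u (2 * Real.pi) = u 0 := by simp only [u, hcc]
  simp only [φ, huu, Function.comp, hcc] at h2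
  have : (2 * Real.pi : ℂ) * Complex.I = 0 := by
    push_cast at h2
    linear_combination h2
  exact Complex.two_pi_I_ne_zero this

/-- After composition with the inverse differential, `g` moves points of a small circle by at most
`r / 2` relative to its centre, and `gn` differs from `g` by less than `r / 2`; the zero criterion
then applies. -/
theorem eventually_exists_eq_of_hasFDerivAt {g : ℂ → ℂ} {gn : ℕ → ℂ → ℂ} {g' : ℂ →L[ℝ] ℂ} {p : ℂ}
    (hg : HasFDerivAt g g' p) (hdet : g'.det ≠ 0) (hgn : ∀ n, Continuous (gn n))
    (hconv : TendstoUniformly gn g atTop) {R : ℝ} (hR : 0 < R) :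
    ∀ᶠ n in atTop, ∃ z ∈ Metric.closedBall p R, gn n z = g p := by
  let e : ℂ ≃L[ℝ] ℂ := g'.toContinuousLinearEquivOfDetNeZero hdet
  have hd : HasFDerivAt (fun z ↦ e.symm (g z)) (ContinuousLinearMap.id ℝ ℂ) p := by
    refine (e.symm.hasFDerivAt.comp p hg).congr_fderiv ?_
    ext1
    all_goals exact e.symm_apply_apply _
  have hd' := hd.isLittleO.def (c := 1 / 2) (by norm_num)
  obtain ⟨r₀, hr₀, hball⟩ := Metric.eventually_nhds_iff.1 hd'
  set r := min R (r₀ / 2) with hr_def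
  have hr : 0 < r := lt_min hR (by positivity)
  have hrr : r < r₀ := (min_le_right _ _).trans_lt (by linarith)
  have huc : UniformContinuous fun z ↦ e.symm z := (e.symm : ℂ →L[ℝ] ℂ).uniformContinuous
  filter_upwards [Metric.tendstoUniformly_iff.1 (huc.comp_tendstoUniformly hconv) (r / 2)
    (by positivity)] with n hn
  obtain ⟨z, hz, hz0⟩ := Complex.exists_mem_closedBall_eq_zero
    (g := fun v ↦ e.symm (gn n (p + v)) - e.symm (g p))
    ((e.symm.continuous.comp ((hgn n).comp (by fun_prop))).sub continuous_const) hr (by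
      intro v hv
      have h1 := hball (y := p + v) (by simpa [hv] using hrr)
      have h2 := hn (p + v)
      simp only [add_sub_cancel_left, ContinuousLinearMap.id_apply, hv] at h1
      simp only [Function.comp, dist_eq_norm] at h2
      rw [norm_sub_rev] at h2
      calc _ = ‖(e.symm (gn n (p + v)) - e.symm (g (p + v)))
              + (e.symm (g (p + v)) - e.symm (g p) - v)‖ := by congr 1; ring
        _ ≤ _ := norm_add_le _ _
        _ < r / 2 + r / 2 := by linarith
        _ = r := by ring)
  refine ⟨p + z, ?_, e.symm.injective (sub_eq_zero.1 hz0)⟩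
  simp only [mem_closedBall_zero_iff] at hz
  simpa using hz.trans (min_le_left _ _)

/-! ### Lower semicontinuity of shadows -/

instance isAddHaarMeasure_hausdorffMeasure_complex :
    (μH[2] : Measure ℂ).IsAddHaarMeasure := by
  simpa [Complex.finrank_real_complex] using isAddHaarMeasure_hausdorffMeasure (E := ℂ)

theorem hausdorffMeasure_image_clm_le_liminf {G : Type*} [NormedAddCommGroup G] [NormedSpace ℝ G]
    {F : ℂ → G} {Fn : ℕ → ℂ → G} {K : ℝ≥0}
    (hF : LipschitzWith K F) (hFn : ∀ n, Continuous (Fn n)) (hconv : TendstoUniformly Fn F atTop)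
    (P : G →L[ℝ] ℂ) {U : Set G} (hU : IsOpen U) :
    μH[2] (P '' (Set.range F ∩ U)) ≤ liminf (fun n ↦ μH[2] (P '' (Set.range (Fn n) ∩ U))) atTop := by
  let g : ℂ → ℂ := fun z ↦ P (F z)
  have hg : LipschitzWith (‖P‖₊ * K) g := P.lipschitz.comp hF
  let N : Set ℂ := {p | ¬ DifferentiableAt ℝ g p}
  let Z : Set ℂ := {p | DifferentiableAt ℝ g p ∧ (fderiv ℝ g p).det = 0}
  have hN : μH[2] (g '' N) = 0 := by
    have h0 : μH[2] N = 0 := hg.ae_differentiableAt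
    have := hg.hausdorffMeasure_image_le (d := 2) (by norm_num) N
    rw [h0, mul_zero] at this
    exact le_antisymm this zero_le
  have hZ : μH[2] (g '' Z) = 0 :=
    addHaar_image_eq_zero_of_det_fderivWithin_eq_zero _
      (fun x hx ↦ hx.1.hasFDerivAt.hasFDerivWithinAt) fun x hx ↦ hx.2
  -- Values attained by every surface from index `n` on; these sets increase, so continuity from
  -- below applies.
  let T : ℕ → Set ℂ := fun n ↦ ⋂ m ≥ n, P '' (Set.range (Fn m) ∩ U)
  have hT : Monotone T := fun a b hab ↦
    Set.iInter₂_mono' fun i hi ↦ ⟨i, hab.trans hi, subset_rfl⟩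
  have hsub : P '' (Set.range F ∩ U) ⊆ (⋃ n, T n) ∪ (g '' N ∪ g '' Z) := by
    rintro _ ⟨_, ⟨⟨p, rfl⟩, hpU⟩, rfl⟩
    by_cases hp : DifferentiableAt ℝ g p
    swap
    · exact Or.inr (Or.inl ⟨p, hp, rfl⟩)
    by_cases hdet : (fderiv ℝ g p).det = 0
    · exact Or.inr (Or.inr ⟨p, ⟨hp, hdet⟩, rfl⟩)
    left
    obtain ⟨δ, hδ, hδU⟩ := Metric.isOpen_iff.1 hU _ hpU
    obtain ⟨R, hR, hRF⟩ := Metric.continuous_iff.1 hF.continuous p (δ / 2) (by positivity)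
    have h1 := eventually_exists_eq_of_hasFDerivAt hp.hasFDerivAt hdet
      (fun n ↦ P.continuous.comp (hFn n)) (P.uniformContinuous.comp_tendstoUniformly hconv)
      (half_pos hR)
    have h2 := Metric.tendstoUniformly_iff.1 hconv (δ / 2) (by positivity)
    obtain ⟨n, hn⟩ := eventually_atTop.1 (h1.and h2)
    refine Set.mem_iUnion.2 ⟨n, Set.mem_iInter₂.2 fun m hm ↦ ?_⟩
    obtain ⟨⟨z, hz, hzp⟩, hm2⟩ := hn m hm
    refine ⟨Fn m z, ⟨⟨z, rfl⟩, hδU ?_⟩, hzp⟩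
    have h3 := hRF z ((Metric.mem_closedBall.1 hz).trans_lt (half_lt_self hR))
    have h4 := hm2 z
    rw [dist_comm] at h4
    rw [Metric.mem_ball]
    linarith [dist_triangle (Fn m z) (F z) (F p)]
  calc _ ≤ μH[2] ((⋃ n, T n) ∪ (g '' N ∪ g '' Z)) := measure_mono hsub
    _ ≤ μH[2] (⋃ n, T n) + (μH[2] (g '' N) + μH[2] (g '' Z)) :=
      (measure_union_le _ _).trans (by gcongr; exact measure_union_le _ _)
    _ = ⨆ n, μH[2] (T n) := by rw [hN, hZ, hT.measure_iUnion]; simp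
    _ ≤ _ := by
      rw [liminf_eq_iSup_iInf_of_nat]
      exact iSup_mono fun n ↦ le_iInf₂ fun m hm ↦ measure_mono (Set.iInter₂_subset m hm)

/-! ### Images of critical points -/

/-- On `t`, `f` factors through `g` by a `C`-Lipschitz map. -/
theorem hausdorffMeasure_image_le_of_dist_le {α X Y : Type*} [MetricSpace X]
    [MeasurableSpace X] [BorelSpace X] [MetricSpace Y] [MeasurableSpace Y] [BorelSpace Y]
    {f : α → X} {g : α → Y} {t : Set α} {C : ℝ≥0}
    (h : ∀ x ∈ t, ∀ y ∈ t, dist (f x) (f y) ≤ C * dist (g x) (g y)) {d : ℝ} (hd : 0 ≤ d) :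
    μH[d] (f '' t) ≤ (C : ℝ≥0∞) ^ d * μH[d] (g '' t) := by
  rcases t.eq_empty_or_nonempty with rfl | ⟨x₀, hx₀⟩
  · simp
  have : Nonempty α := ⟨x₀⟩
  let k := Function.invFunOn g t
  have hk : ∀ x ∈ t, k (g x) ∈ t ∧ g (k (g x)) = g x := fun x hx ↦
    ⟨Function.invFunOn_mem ⟨x, hx, rfl⟩, Function.invFunOn_eq ⟨x, hx, rfl⟩⟩
  have hfk : ∀ x ∈ t, f (k (g x)) = f x := fun x hx ↦ by
    have := h _ (hk x hx).1 x hx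
    rw [(hk x hx).2, dist_self, mul_zero] at this
    exact dist_le_zero.1 this
  have hL : LipschitzOnWith C (f ∘ k) (g '' t) := by
    refine LipschitzOnWith.of_dist_le_mul ?_
    rintro _ ⟨x, hx, rfl⟩ _ ⟨y, hy, rfl⟩
    simpa only [Function.comp, hfk x hx, hfk y hy] using h x hx y hy
  have := hL.hausdorffMeasure_image_le hd
  have himg : (f ∘ k) '' (g '' t) = f '' t := by
    rw [Set.image_image]; exact Set.image_congr hfk
  rwa [himg] at this

/-- A map which is close to a linear map of rank at most one has an image of small area. -/
theorem hausdorffMeasure_image_le_of_approximatesLinearOn {G : Type*} [NormedAddCommGroup G]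
    [NormedSpace ℝ G] [MeasurableSpace G] [BorelSpace G] {F : ℂ → G} {A : ℂ →L[ℝ] G} {t : Set ℂ}
    {K δ : ℝ≥0} (hF : ApproximatesLinearOn F A t δ) (hA : ¬ Function.Injective A) (hK : ‖A‖ ≤ K) :
    μH[2] (F '' t) ≤ 4 * (δ * (K + δ)) * μH[2] t := by
  obtain ⟨e, hAe, he⟩ : ∃ e : ℂ, A e = 0 ∧ ‖e‖ = 1 := by
    rw [injective_iff_map_eq_zero] at hA
    push Not at hA
    obtain ⟨v, hv, hv0⟩ := hA
    exact ⟨(‖v‖⁻¹ : ℝ) • v, by rw [map_smul, hv, smul_zero], by simp [hv0]⟩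
  have hee : e * (starRingEnd ℂ) e = 1 := by
    rw [Complex.mul_conj, Complex.normSq_eq_norm_sq, he]; simp
  -- In coordinates whose real axis is the kernel direction `e`, `F` stretches by about `δ` along it
  -- and by at most `K + δ` across it; `D` dominates this and has small determinant.
  let D : ℂ →ₗ[ℝ] ℂ := Matrix.toLin Complex.basisOneI Complex.basisOneI !![(δ : ℝ), 0; 0, K + δ]
  have hD : ∀ v, D v = ⟨δ * v.re, (K + δ) * v.im⟩ := by
    intro v
    simp [D, Matrix.toLin_apply, Matrix.mulVec, dotProduct, Fin.sum_univ_two, Complex.ext_iff]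
  have hdet : LinearMap.det D = δ * (K + δ) := by
    simp [D, LinearMap.det_toLin, Matrix.det_fin_two]
  let ρ : ℂ → ℂ := fun v ↦ (starRingEnd ℂ) e * v
  have hρ : Isometry ρ := Isometry.of_dist_eq fun x y ↦ by
    simp [ρ, dist_eq_norm, ← mul_sub, he]
  have key : ∀ x ∈ t, ∀ y ∈ t, dist (F x) (F y) ≤ (2 : ℝ≥0) * dist (D (ρ x)) (D (ρ y)) := by
    intro x hx y hy
    set v := x - y with hv
    set w := (starRingEnd ℂ) e * v with hw
    have hvw : v = e * w := by rw [hw, ← mul_assoc, hee, one_mul]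
    have h1 : ‖A v‖ ≤ K * |w.im| := by
      have : v = w.re • e + w.im • (e * Complex.I) := by
        rw [hvw]
        conv_lhs => rw [← Complex.re_add_im w]
        simp only [Complex.real_smul]; ring
      rw [this, map_add, map_smul, map_smul, hAe, smul_zero, zero_add, norm_smul, mul_comm,
        Real.norm_eq_abs]
      gcongr
      refine (A.le_opNorm _).trans ?_
      simpa [he] using hK
    have h2 : ‖v‖ ≤ |w.re| + |w.im| := by
      rw [hvw, norm_mul, he, one_mul]; exact Complex.norm_le_abs_re_add_abs_im w
    have h3 := hF x hx y hy
    have h4 : dist (D (ρ x)) (D (ρ y)) = ‖D w‖ := by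
      rw [dist_eq_norm, ← map_sub]; simp only [ρ, ← mul_sub, hw, hv]
    have h5 : δ * |w.re| ≤ ‖D w‖ := by
      have := Complex.abs_re_le_norm (D w)
      rwa [hD, abs_mul, abs_of_nonneg δ.coe_nonneg, ← hD] at this
    have h6 : (K + δ) * |w.im| ≤ ‖D w‖ := by
      have := Complex.abs_im_le_norm (D w)
      rwa [hD, abs_mul, abs_of_nonneg (add_nonneg K.coe_nonneg δ.coe_nonneg), ← hD] at this
    rw [h4, dist_eq_norm]
    have h7 : ‖F x - F y‖ ≤ ‖F x - F y - A (x - y)‖ + ‖A v‖ := by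
      simpa [hv] using norm_add_le (F x - F y - A (x - y)) (A v)
    have h8 : δ * ‖v‖ ≤ δ * (|w.re| + |w.im|) := by gcongr
    push_cast
    linarith
  have := hausdorffMeasure_image_le_of_dist_le key (d := 2) (by norm_num)
  refine this.trans_eq ?_
  rw [← Set.image_image D ρ, Measure.addHaar_image_linearMap, hdet,
    hρ.hausdorffMeasure_image (Or.inl (by norm_num)), ← mul_assoc,
    abs_of_nonneg (by positivity), ENNReal.ofReal_mul δ.coe_nonneg,
    ENNReal.ofReal_add K.coe_nonneg δ.coe_nonneg]
  simp only [ENNReal.ofReal_coe_nnreal]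
  norm_num

/-- Sard's theorem for Lipschitz maps of the plane: the points at which the differential is not
injective have an image of area zero. -/
theorem LipschitzWith.hausdorffMeasure_image_not_injective_fderiv {G : Type*}
    [NormedAddCommGroup G] [NormedSpace ℝ G] [SecondCountableTopology G] [MeasurableSpace G]
    [BorelSpace G] {F : ℂ → G} {K : ℝ≥0} (hF : LipschitzWith K F) :
    μH[2] (F '' {p | DifferentiableAt ℝ F p ∧ ¬ Function.Injective (fderiv ℝ F p)}) = 0 := by
  set Z := {p | DifferentiableAt ℝ F p ∧ ¬ Function.Injective (fderiv ℝ F p)}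
  suffices H : ∀ R : ℕ, μH[2] (F '' (Z ∩ Metric.closedBall 0 R)) = 0 by
    rw [← Metric.iUnion_inter_closedBall_nat Z 0, Set.image_iUnion]
    exact measure_iUnion_null H
  intro R
  set Y := Z ∩ Metric.closedBall (0 : ℂ) R with hY
  have hfin : μH[2] Y ≠ ∞ := ((measure_mono Set.inter_subset_right).trans_lt
    (isCompact_closedBall (0 : ℂ) R).measure_lt_top).ne
  rcases Y.eq_empty_or_nonempty with h0 | hne
  · rw [h0]; simp
  have bound : ∀ δ : ℝ≥0, 0 < δ → μH[2] (F '' Y) ≤ 4 * (δ * (K + δ)) * μH[2] Y := by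
    intro δ hδ
    obtain ⟨t, A, hdisj, htm, hcov, happ, hA⟩ :=
      exists_partition_approximatesLinearOn_of_hasFDerivWithinAt F Y (fderiv ℝ F)
        (fun x hx ↦ hx.1.1.hasFDerivAt.hasFDerivWithinAt) (fun _ ↦ δ) (fun _ ↦ hδ.ne')
    have hYt : Y = ⋃ n, Y ∩ t n := by rw [← Set.inter_iUnion, Set.inter_eq_left.2 hcov]
    calc μH[2] (F '' Y) = μH[2] (⋃ n, F '' (Y ∩ t n)) := by rw [← Set.image_iUnion, ← hYt]
      _ ≤ ∑' n, μH[2] (F '' (Y ∩ t n)) := measure_iUnion_le _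
      _ ≤ ∑' n, 4 * (δ * (K + δ)) * μH[2] (Y ∩ t n) := by
        refine ENNReal.tsum_le_tsum fun n ↦ ?_
        obtain ⟨y, hy, hAy⟩ := hA hne n
        refine hausdorffMeasure_image_le_of_approximatesLinearOn (happ n) ?_ ?_
        · rw [hAy]; exact hy.1.2
        · rw [hAy]; exact norm_fderiv_le_of_lipschitz ℝ hF
      _ = 4 * (δ * (K + δ)) * μH[2] Y := by
        rw [ENNReal.tsum_mul_left]
        congr 1
        simp_rw [Set.inter_comm Y, ← Measure.restrict_apply (htm _)]
        rw [← measure_iUnion hdisj htm, Measure.restrict_apply (MeasurableSet.iUnion htm),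
          Set.inter_eq_right.2 hcov]
  have hlim : Tendsto (fun δ : ℝ≥0 ↦ (4 * (δ * (K + δ)) : ℝ≥0∞) * μH[2] Y) (𝓝[>] 0) (𝓝 0) := by
    have h1 : Tendsto (fun δ : ℝ≥0 ↦ 4 * (δ * (K + δ))) (𝓝[>] 0) (𝓝 0) := by
      have : Continuous fun δ : ℝ≥0 ↦ 4 * (δ * (K + δ)) := by fun_prop
      simpa using (this.tendsto 0).mono_left nhdsWithin_le_nhds
    have h2 := ENNReal.Tendsto.mul_const (ENNReal.tendsto_coe.2 h1) (Or.inr hfin)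
    simpa using h2
  exact le_antisymm (ge_of_tendsto hlim (eventually_mem_nhdsWithin.mono fun δ hδ ↦ bound δ hδ))
    zero_le

/-! ### Almost isometric projections -/

section Inner

variable {G : Type*} [NormedAddCommGroup G] [InnerProductSpace ℝ G] [FiniteDimensional ℝ G]

omit [FiniteDimensional ℝ G] in
theorem exists_clm_norm_le_one_isometric_on_range {A : ℂ →L[ℝ] G} (hA : Function.Injective A) :
    ∃ P : G →L[ℝ] ℂ, ‖P‖ ≤ 1 ∧ ∀ v, ‖P (A v)‖ = ‖A v‖ := by
  let V : Submodule ℝ G := LinearMap.range (A : ℂ →ₗ[ℝ] G)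
  have hV : Module.finrank ℝ V = Module.finrank ℝ ℂ := LinearMap.finrank_range_of_inj hA
  let e : V ≃ₗᵢ[ℝ] ℂ := (stdOrthonormalBasis ℝ V).equiv (stdOrthonormalBasis ℝ ℂ)
    (finCongr hV)
  refine ⟨(e.toContinuousLinearEquiv : V →L[ℝ] ℂ).comp V.orthogonalProjectionOnto, ?_, fun v ↦ ?_⟩
  · refine ContinuousLinearMap.opNorm_le_bound _ zero_le_one fun x ↦ ?_
    simpa using V.norm_orthogonalProjectionOnto_apply_le x
  · have : V.orthogonalProjectionOnto (A v) = ⟨A v, v, rfl⟩ :=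
      V.orthogonalProjectionOnto_mem_subspace_eq_self ⟨A v, v, rfl⟩
    simp [this]

omit [FiniteDimensional ℝ G] in
-- An error `E` with `‖E‖ ≤ r * ‖v‖` then satisfies `‖A v‖ + ‖E‖ ≤ C * (‖A v‖ - ‖E‖)`.
theorem exists_pos_mul_norm_le {A : ℂ →L[ℝ] G} (hA : Function.Injective A) {C : ℝ≥0} (hC : 1 < C) :
    ∃ r : ℝ≥0, 0 < r ∧ ∀ v, r * (1 + C) * ‖v‖ ≤ (C - 1) * ‖A v‖ := by
  obtain ⟨κ, hκ, hanti⟩ := (A : ℂ →ₗ[ℝ] G).exists_antilipschitzWith (LinearMap.ker_eq_bot.2 hA)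
  refine ⟨(C - 1) / ((1 + C) * κ), div_pos (tsub_pos_of_lt hC) (by positivity), fun v ↦ ?_⟩
  have h : ‖v‖ ≤ κ * ‖A v‖ := by simpa using hanti.le_mul_dist v 0
  have hκ' : (0 : ℝ) < κ := by exact_mod_cast hκ
  have hC' : (1 : ℝ) < C := by exact_mod_cast hC
  rw [NNReal.coe_div, NNReal.coe_sub hC.le]
  push_cast
  calc _ = ((C : ℝ) - 1) / κ * ‖v‖ := by field_simp
    _ ≤ ((C : ℝ) - 1) / κ * (κ * ‖A v‖) := by
      have := sub_pos.2 hC'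
      gcongr
    _ = _ := by field_simp

/-- The points where the differential is injective are covered by countably many sets on each of
which some orthogonal projection onto a plane is nearly isometric on the image. -/
theorem exists_cover_almost_isometric_projection (F : ℂ → G) {C : ℝ≥0} (hC : 1 < C) :
    ∃ (t : ℕ → Set ℂ) (P : ℕ → G →L[ℝ] ℂ),
      {p | DifferentiableAt ℝ F p ∧ Function.Injective (fderiv ℝ F p)} ⊆ ⋃ n, t n ∧
      ∀ n, ‖P n‖ ≤ 1 ∧ ∀ x ∈ t n, ∀ y ∈ t n, dist (F x) (F y) ≤ C * dist (P n (F x)) (P n (F y)) := by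
  classical
  set s := {p | DifferentiableAt ℝ F p ∧ Function.Injective (fderiv ℝ F p)} with hs
  rcases s.eq_empty_or_nonempty with h0 | hne
  · exact ⟨fun _ ↦ ∅, fun _ ↦ 0, by simp [h0], by simp⟩
  have hr : ∀ A : ℂ →L[ℝ] G, ∃ r : ℝ≥0, r ≠ 0 ∧
      (Function.Injective A → ∀ v, r * (1 + C) * ‖v‖ ≤ (C - 1) * ‖A v‖) := by
    intro A
    by_cases hA : Function.Injective A
    · obtain ⟨r, h1, h2⟩ := exists_pos_mul_norm_le hA hC
      exact ⟨r, h1.ne', fun _ ↦ h2⟩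
    · exact ⟨1, one_ne_zero, fun h ↦ (hA h).elim⟩
  choose r hr0 hrA using hr
  obtain ⟨t, A, -, hcov, happ, hA⟩ :=
    exists_closed_cover_approximatesLinearOn_of_hasFDerivWithinAt F s (fderiv ℝ F)
      (fun x hx ↦ hx.1.hasFDerivAt.hasFDerivWithinAt) r hr0
  have hinj : ∀ n, Function.Injective (A n) := fun n ↦ by
    obtain ⟨y, hy, h⟩ := hA hne n
    rw [h]; exact hy.2
  choose P hP1 hPA using fun n ↦ exists_clm_norm_le_one_isometric_on_range (hinj n)
  refine ⟨fun n ↦ s ∩ t n, P, fun x hx ↦ ?_, fun n ↦ ⟨hP1 n, fun x hx y hy ↦ ?_⟩⟩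
  · rw [← Set.inter_iUnion]; exact ⟨hx, hcov hx⟩
  have h1 := happ n x hx y hy
  have h2 := hrA _ (hinj n) (x - y)
  have h3 := hPA n (x - y)
  set v := x - y
  set E := F x - F y - A n v with hE
  have hFE : F x - F y = E + A n v := by rw [hE]; abel
  have h4 : ‖F x - F y‖ ≤ ‖E‖ + ‖A n v‖ := hFE ▸ norm_add_le _ _
  have h5 : ‖P n E‖ ≤ ‖E‖ := ((P n).le_of_opNorm_le (hP1 n) E).trans_eq (one_mul _)
  have h6 : ‖A n v‖ ≤ ‖P n (F x - F y)‖ + ‖P n E‖ := by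
    rw [← h3, hFE, map_add]
    simpa using norm_sub_le (P n E + P n (A n v)) (P n E)
  rw [dist_eq_norm, dist_eq_norm, ← map_sub]
  have hC' : (0 : ℝ) ≤ C := C.2
  have h7 : C * ‖A n v‖ ≤ C * (‖P n (F x - F y)‖ + r (A n) * ‖v‖) := by
    gcongr; linarith
  linarith

end Inner

/-! ### Adding local estimates by superadditivity -/

theorem ENNReal.liminf_add_liminf_le_liminf_add (u v : ℕ → ℝ≥0∞) :
    liminf u atTop + liminf v atTop ≤ liminf (fun n ↦ u n + v n) atTop := by
  simp only [liminf_eq_iSup_iInf_of_nat]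
  rw [ENNReal.iSup_add_iSup_of_monotone]
  · exact iSup_mono fun n ↦ le_iInf₂ fun i hi ↦ add_le_add (iInf₂_le i hi) (iInf₂_le i hi)
  all_goals exact fun a b hab ↦ iInf₂_mono' fun i hi ↦ ⟨i, hab.trans hi, le_rfl⟩

/-- Disjoint compact sets have disjoint open neighbourhoods, so superadditivity applies one set at a
time. -/
theorem sum_le_of_compacts_of_superadditive {X ι : Type*} [TopologicalSpace X] [T2Space X]
    {lam : Set X → ℝ≥0∞}
    (hsup : ∀ U V W, IsOpen U → IsOpen V → Disjoint U V → U ∪ V ⊆ W → lam U + lam V ≤ lam W)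
    {a : ι → ℝ≥0∞} {K : ι → Set X} (hK : ∀ i, IsCompact (K i))
    (hdisj : Pairwise (Function.onFun Disjoint K))
    (ha : ∀ i U, IsOpen U → K i ⊆ U → a i ≤ lam U) (s : Finset ι) :
    ∀ A, IsOpen A → (∀ i ∈ s, K i ⊆ A) → ∑ i ∈ s, a i ≤ lam A := by
  classical
  induction s using Finset.induction_on with
  | empty => simp
  | insert j s hj ih =>
    intro A hA hKA
    rw [Finset.sum_insert hj]
    obtain ⟨U, V, hU, hV, hjU, hsV, hUV⟩ :=
      SeparatedNhds.of_isCompact_isCompact (hK j) (s.isCompact_biUnion fun i _ ↦ hK i)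
        (Set.disjoint_iUnion₂_right.2 fun i hi ↦ hdisj (ne_of_mem_of_not_mem hi hj).symm)
    refine (add_le_add (ha j (A ∩ U) (hA.inter hU)
      (Set.subset_inter (hKA j (Finset.mem_insert_self _ _)) hjU))
      (ih (A ∩ V) (hA.inter hV) fun i hi ↦ Set.subset_inter (hKA i (Finset.mem_insert_of_mem hi))
        ((Set.subset_biUnion_of_mem (u := K) hi).trans hsV))).trans ?_
    exact hsup _ _ _ (hA.inter hU) (hA.inter hV)
      (hUV.mono Set.inter_subset_right Set.inter_subset_right)
      (Set.union_subset Set.inter_subset_left Set.inter_subset_left)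

theorem measure_inter_iUnion_le_of_superadditive {X : Type*} [TopologicalSpace X] [T2Space X]
    [MeasurableSpace X] [BorelSpace X] {μ : Measure X} [IsFiniteMeasure μ]
    [μ.InnerRegularCompactLTTop] {lam : Set X → ℝ≥0∞}
    (hsup : ∀ U V W, IsOpen U → IsOpen V → Disjoint U V → U ∪ V ⊆ W → lam U + lam V ≤ lam W)
    {C : ℕ → Set X} (hC : ∀ i, IsClosed (C i))
    (h : ∀ i K U, K ⊆ C i → IsOpen U → K ⊆ U → μ K ≤ lam U) {A : Set X} (hA : IsOpen A) :
    μ (A ∩ ⋃ i, C i) ≤ lam A := by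
  let E : ℕ → Set X := fun i ↦ A ∩ disjointed C i
  have hEm : ∀ i, MeasurableSet (E i) := fun i ↦
    hA.measurableSet.inter (MeasurableSet.disjointed (fun i ↦ (hC i).measurableSet) i)
  have hEd : Pairwise (Function.onFun Disjoint E) := fun i j hij ↦
    (disjoint_disjointed C hij).mono Set.inter_subset_right Set.inter_subset_right
  have hAE : A ∩ ⋃ i, C i = ⋃ i, E i := by rw [← iUnion_disjointed, Set.inter_iUnion]
  rw [hAE]
  refine ENNReal.le_of_forall_pos_le_add fun ε hε _ ↦ ?_
  obtain ⟨ε', hε', hsum⟩ := ENNReal.exists_pos_sum_of_countable (ENNReal.coe_pos.2 hε).ne' ℕ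
  choose K hKE hK hμK using fun i ↦ (hEm i).exists_isCompact_lt_add (measure_ne_top μ (E i))
    (ENNReal.coe_pos.2 (hε' i)).ne'
  calc μ (⋃ i, E i) ≤ ∑' i, μ (E i) := measure_iUnion_le _
    _ ≤ ∑' i, (μ (K i) + ε' i) := ENNReal.tsum_le_tsum fun i ↦ (hμK i).le
    _ = ∑' i, μ (K i) + ∑' i, (ε' i : ℝ≥0∞) := ENNReal.tsum_add
    _ ≤ lam A + ε := by
      gcongr
      rw [ENNReal.tsum_eq_iSup_sum]
      refine iSup_le fun s ↦ ?_
      exact sum_le_of_compacts_of_superadditive hsup hK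
        (fun i j hij ↦ (hEd hij).mono (hKE i) (hKE j))
        (fun i U hU hKU ↦ h i (K i) U
          ((hKE i).trans (Set.inter_subset_right.trans (disjointed_subset C i))) hU hKU) s A hA
        fun i _ ↦ (hKE i).trans Set.inter_subset_left

/-! ### Lower semicontinuity for maps of the plane -/

section Inner

variable {G : Type*} [NormedAddCommGroup G] [InnerProductSpace ℝ G] [FiniteDimensional ℝ G]
  [MeasurableSpace G] [BorelSpace G]

omit [FiniteDimensional ℝ G] in
theorem hausdorffMeasure_le_liminf_of_almost_isometric_projection {F : ℂ → G} {Fn : ℕ → ℂ → G}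
    {L : ℝ≥0} (hF : LipschitzWith L F) (hFn : ∀ n, Continuous (Fn n))
    (hconv : TendstoUniformly Fn F atTop) {C : ℝ≥0} {P : G →L[ℝ] ℂ} (hP : ‖P‖ ≤ 1) {K U : Set G}
    (hKF : K ⊆ Set.range F) (hK : ∀ x ∈ K, ∀ y ∈ K, dist x y ≤ C * dist (P x) (P y))
    (hU : IsOpen U) (hKU : K ⊆ U) :
    μH[2] K ≤ (C : ℝ≥0∞) ^ 2 * liminf (fun n ↦ μH[2] (Set.range (Fn n) ∩ U)) atTop := by
  have h1 := hausdorffMeasure_image_le_of_dist_le (f := id) hK (d := 2) (by norm_num)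
  rw [Set.image_id, ENNReal.rpow_two] at h1
  refine h1.trans ?_
  gcongr
  calc μH[2] (P '' K) ≤ μH[2] (P '' (Set.range F ∩ U)) := by
        gcongr; exact Set.subset_inter hKF hKU
    _ ≤ liminf (fun n ↦ μH[2] (P '' (Set.range (Fn n) ∩ U))) atTop :=
      hausdorffMeasure_image_clm_le_liminf hF hFn hconv P hU
    _ ≤ _ := by
      refine liminf_le_liminf (Eventually.of_forall fun n ↦ ?_)
      have := (P.lipschitz.weaken (K' := 1) hP).hausdorffMeasure_image_le (d := 2) (by norm_num)
        (Set.range (Fn n) ∩ U)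
      simpa using this

/-- Lower semicontinuity of the area of the image under uniform convergence of continuous maps of
the plane to a Lipschitz map whose image is covered by a compact part of the plane. -/
theorem hausdorffMeasure_range_inter_le_liminf {F : ℂ → G} {Fn : ℕ → ℂ → G}
    {L : ℝ≥0} (hF : LipschitzWith L F) (hFn : ∀ n, Continuous (Fn n))
    (hconv : TendstoUniformly Fn F atTop) {D : Set ℂ} (hD : IsCompact D)
    (hFD : F '' D = Set.range F) {A : Set G} (hA : IsOpen A) :
    μH[2] (Set.range F ∩ A) ≤ liminf (fun n ↦ μH[2] (Set.range (Fn n) ∩ A)) atTop := by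
  set S := Set.range F with hS
  have hSc : IsCompact S := hFD ▸ hD.image hF.continuous
  set lam : Set G → ℝ≥0∞ := fun U ↦ liminf (fun n ↦ μH[2] (Set.range (Fn n) ∩ U)) atTop
  have hsup : ∀ U V W, IsOpen U → IsOpen V → Disjoint U V → U ∪ V ⊆ W →
      lam U + lam V ≤ lam W := by
    intro U V W hU hV hUV hW
    refine (ENNReal.liminf_add_liminf_le_liminf_add _ _).trans
      (liminf_le_liminf (Eventually.of_forall fun n ↦ ?_))
    rw [← measure_inter_add_sdiff (Set.range (Fn n) ∩ W) hU.measurableSet]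
    refine add_le_add (measure_mono ?_) (measure_mono ?_)
    · exact fun x hx ↦ ⟨⟨hx.1, hW (Or.inl hx.2)⟩, hx.2⟩
    · exact fun x hx ↦ ⟨⟨hx.1, hW (Or.inr hx.2)⟩, fun h ↦ Set.disjoint_left.1 hUV h hx.2⟩
  have hSfin : μH[2] S < ∞ := by
    rw [← hFD]
    refine (hF.hausdorffMeasure_image_le (d := 2) (by norm_num) D).trans_lt ?_
    rw [ENNReal.rpow_two]
    exact ENNReal.mul_lt_top (ENNReal.pow_lt_top ENNReal.coe_lt_top) hD.measure_lt_top
  let μ : Measure G := (μH[2]).restrict S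
  have : IsFiniteMeasure μ := ⟨by simpa [μ] using hSfin⟩
  have hnull : μH[2] (F '' {p | ¬ DifferentiableAt ℝ F p}) = 0 := by
    have h0 : μH[2] {p | ¬ DifferentiableAt ℝ F p} = 0 := hF.ae_differentiableAt
    have := hF.hausdorffMeasure_image_le (d := 2) (by norm_num) {p | ¬ DifferentiableAt ℝ F p}
    rw [h0, mul_zero] at this
    exact le_antisymm this zero_le
  have hbound : ∀ C : ℝ≥0, 1 < C → μH[2] (S ∩ A) ≤ (C : ℝ≥0∞) ^ 2 * lam A := by
    intro C hC
    obtain ⟨t, P, hcov, ht⟩ := exists_cover_almost_isometric_projection F hC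
    -- The distance bound is a closed condition, so it survives the closure, which makes the pieces
    -- measurable.
    let B : ℕ → Set G := fun i ↦ closure (F '' t i)
    have hBS : ∀ i, B i ⊆ S := fun i ↦
      closure_minimal (Set.image_subset_range _ _) hSc.isClosed
    have hBP : ∀ i, ∀ x ∈ B i, ∀ y ∈ B i, dist x y ≤ C * dist (P i x) (P i y) := by
      intro i x hx y hy
      have hcl : IsClosed {q : G × G | dist q.1 q.2 ≤ C * dist (P i q.1) (P i q.2)} :=
        isClosed_le (by fun_prop) (by fun_prop)
      have hxy : (x, y) ∈ closure ((F '' t i) ×ˢ (F '' t i)) := by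
        rw [closure_prod_eq]; exact ⟨hx, hy⟩
      refine closure_minimal ?_ hcl hxy
      rintro ⟨_, _⟩ ⟨⟨x, hx, rfl⟩, ⟨y, hy, rfl⟩⟩
      exact (ht i).2 x hx y hy
    have hmain : μ (A ∩ ⋃ i, B i) ≤ (C : ℝ≥0∞) ^ 2 * lam A := by
      refine measure_inter_iUnion_le_of_superadditive (lam := fun U ↦ (C : ℝ≥0∞) ^ 2 * lam U)
        (fun U V W hU hV hUV hW ↦ ?_) (fun i ↦ isClosed_closure) (fun i K U hK hU hKU ↦ ?_) hA
      · rw [← mul_add]; gcongr; exact hsup U V W hU hV hUV hW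
      · exact (Measure.restrict_apply_le _ _).trans
          (hausdorffMeasure_le_liminf_of_almost_isometric_projection hF hFn hconv (ht i).1
            (hK.trans (hBS i)) (fun x hx y hy ↦ hBP i x (hK hx) y (hK hy)) hU hKU)
    have hsub : S ∩ A ⊆ ((A ∩ ⋃ i, B i) ∩ S) ∪ (F '' {p | ¬ DifferentiableAt ℝ F p} ∪
        F '' {p | DifferentiableAt ℝ F p ∧ ¬ Function.Injective (fderiv ℝ F p)}) := by
      rintro _ ⟨⟨p, rfl⟩, hpA⟩
      by_cases hp : DifferentiableAt ℝ F p
      swap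
      · exact Or.inr (Or.inl ⟨p, hp, rfl⟩)
      by_cases hi : Function.Injective (fderiv ℝ F p)
      swap
      · exact Or.inr (Or.inr ⟨p, ⟨hp, hi⟩, rfl⟩)
      obtain ⟨i, hi⟩ := Set.mem_iUnion.1 (hcov ⟨hp, hi⟩)
      exact Or.inl ⟨⟨hpA, Set.mem_iUnion.2 ⟨i, subset_closure ⟨p, hi, rfl⟩⟩⟩, ⟨p, rfl⟩⟩
    refine (measure_mono hsub).trans ((measure_union_le _ _).trans ?_)
    rw [measure_union_null hnull hF.hausdorffMeasure_image_not_injective_fderiv, add_zero,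
      ← Measure.restrict_apply' hSc.measurableSet]
    exact hmain
  have hlim : Tendsto (fun C : ℝ≥0 ↦ (C : ℝ≥0∞) ^ 2 * lam A) (𝓝[>] 1) (𝓝 (lam A)) := by
    have h1 : Tendsto (fun C : ℝ≥0 ↦ ((C ^ 2 : ℝ≥0) : ℝ≥0∞)) (𝓝[>] 1) (𝓝 ((1 ^ 2 : ℝ≥0) : ℝ≥0∞)) :=
      ENNReal.tendsto_coe.2 (((continuous_pow 2).tendsto 1).mono_left nhdsWithin_le_nhds)
    simpa using ENNReal.Tendsto.mul_const (b := lam A) h1 (Or.inl (by simp))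
  exact ge_of_tendsto hlim (eventually_mem_nhdsWithin.mono hbound)

end Inner

/-! ### Unrolling the cylinder -/

theorem lemma1p4
    (ℓn : ℕ → Cylinder → Space3) (ℓ : Cylinder → Space3)
    (hn : ∃ K : ℝ≥0, ∀ n, LipschitzWith K (ℓn n))
    (hℓ : ∃ L : ℝ≥0, LipschitzWith L ℓ)
    (hconv : TendstoUniformly ℓn ℓ atTop)
    (A : Set Space3) (hA : IsOpen A) :
    surfaceMeasure ℓ A ≤ liminf (fun n => surfaceMeasure (ℓn n) A) atTop := by
  obtain ⟨K, hK⟩ := hn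
  obtain ⟨L, hL⟩ := hℓ
  let ψ : ℂ → Cylinder := fun z ↦ (Set.projIcc 0 1 zero_le_one z.re, Circle.exp z.im)
  have hψ : LipschitzWith 1 ψ := by
    have h1 : LipschitzWith 1 fun z : ℂ ↦ Set.projIcc (0 : ℝ) 1 zero_le_one z.re :=
      (LipschitzWith.projIcc _).comp Complex.reCLM.lipschitz |>.weaken (by simp)
    have h2 : LipschitzWith 1 fun z : ℂ ↦ Circle.exp z.im := by
      refine LipschitzWith.of_dist_le_mul fun z w ↦ ?_
      have h : (Circle.exp z.im : ℂ) - Circle.exp w.im =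
          Circle.exp w.im * (Complex.exp (Complex.I * (z.im - w.im : ℝ)) - 1) := by
        rw [mul_sub, mul_one, Circle.coe_exp, Circle.coe_exp, ← Complex.exp_add]
        congr 2
        push_cast
        ring
      change dist (Circle.exp z.im : ℂ) (Circle.exp w.im) ≤ _
      rw [dist_eq_norm, h, norm_mul, Circle.norm_coe, one_mul, NNReal.coe_one,
        one_mul, dist_eq_norm]
      refine Real.norm_exp_I_mul_ofReal_sub_one_le.trans ?_
      rw [Real.norm_eq_abs, ← Complex.sub_im]
      exact Complex.abs_im_le_norm _
    simpa using h1.prodMk h2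
  have himg : ψ '' (Set.Icc 0 1 ×ℂ Set.Icc (-Real.pi) Real.pi) = Set.univ := by
    refine Set.eq_univ_of_forall fun ⟨a, c⟩ ↦ ⟨⟨a, Complex.arg c⟩, ⟨a.2, ?_, ?_⟩, ?_⟩
    · exact (Complex.neg_pi_lt_arg _).le
    · exact Complex.arg_le_pi _
    · exact Prod.ext (Set.projIcc_val zero_le_one a) (Circle.exp_arg c)
  have hsurj : Function.Surjective ψ := fun q ↦ by
    obtain ⟨z, -, hz⟩ := himg.symm ▸ Set.mem_univ q
    exact ⟨z, hz⟩
  have key := hausdorffMeasure_range_inter_le_liminf (hL.comp hψ)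
    (fun n ↦ (hK n).continuous.comp hψ.continuous) (hconv.comp ψ)
    (isCompact_Icc.reProdIm isCompact_Icc)
    (by rw [Set.image_comp, himg, Set.image_univ, hsurj.range_comp]) hA
  simp only [hsurj.range_comp, ] at key
  -- The normalized measure is a finite constant times `μH[2]`, and the constant comes out of the
  -- liminf.
  have hmeas : ∀ f : Cylinder → Space3, surfaceMeasure f A =
      (Measure.addHaarScalarFactor (volume : Measure (EuclideanSpace ℝ (Fin 2))) μH[(2 : ℕ)] : ℝ≥0∞) *
        μH[2] (Set.range f ∩ A) := by
    intro f
    rw [surfaceMeasure, Measure.restrict_apply hA.measurableSet, Set.inter_comm,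
      Measure.euclideanHausdorffMeasure_def, Measure.smul_apply, surfaceOf]
    simp [ENNReal.smul_def]
  simp only [hmeas]
  rw [ENNReal.liminf_const_mul_of_ne_top ENNReal.coe_ne_top]
  gcongr
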